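/- Let $\gamma>1$, let either $\mu=1$ and $0\le\lambda\le2$, or $\mu>1$ and $\lambda\ge0$, and put $p(u)=u^{-\gamma}/\gamma$. Consider the Cauchy problem $$u_t-v_x=0,\qquad v_t+p(u)_x=-\frac{\lambda}{(1+t)^\mu}\,v,\qquad (u,v)(0,x)=(u_0(x),v_0(x)),\qquad t\ge0,\ x\in\mathbb R,$$ with Riemann invariants $r=v-\eta$, $s=v+\eta$, where $\eta=\int_u^\infty\sqrt{-p'(\xi)}\,d\xi=\frac{2}{\gamma-1}u^{-(\gamma-1)/2}$. For $m,\delta>0$ let $X_{m,\delta}$ be the set of pairs $(u,v)$ of bounded $C^1$ functions on $\mathbb R$ with bounded derivatives such that $\|u\|_{L^\infty}+\|v\|_{L^\infty}\le m$ and $u\ge\delta$. For a $C^1$ solution with $u>0$ put $$N(t)=\|(u,v)(t)\|_{L^\infty}+\|(u_t,v_t)(t)\|_{L^\infty}+\|(u_x,v_x)(t)\|_{L^\infty}+\|p'(u(t))\|_{L^\infty}.$$ The lifespan $T^*\in[0,\infty]$ of the data $(u_0,v_0)$ is the supremum of all $T>0$ for which there is a $C^1$ solution with $u>0$ on $[0,T)\times\mathbb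 R$ such that $\sup_{[0,T)}N<\infty$. Below, a solution on $[0,T)$, $T\le\infty$, is a $C^1$ solution with $u>0$ on $[0,T)\times\mathbb R$ such that $\sup_{[0,T')}N<\infty$ for every $T'<T$. For all $m,\delta>0$ there are constants $m_1,\delta_1,K>0$, depending only on $\gamma,\lambda,\mu,m,\delta$, such that the following holds for all $(u_0,v_0)\in X_{m,\delta}$ for which $$\lim_{x\to-\infty}(u_0(x),v_0(x))=(u_-,v_-)\ \text{ with } u_->0,\ v_-\in\mathbb R,\qquad \sup_{(x,y)\in\mathbb R^2}|s(0,x)+r(0,y)|<\frac{1}{\gamma-1}\,u_-^{-(\gamma-1)/2}.$$ (i) If $(u,v)$ is a solution on $[0,T)$ (in particular, if it is the solution on $[0,T^*)$), then $(u(t),v(t))\in X_{m_1,\delta_1}$ for all $t\in[0,T)$. In particular $u$, $v$ and $p'(u)$ stay uniformly bounded, and $u$ is bounded away from $0$. (ii) If in addition $r_x(0,x_0)\le-K$ or $s_x(0,x_0)\le-K$ for some $x_0\in\mathbb R$, then $T^*<\infty$. Moreover, if a solution $(u,v)$ on $[0,T)$ breaks down at $T$, that is, $\sup_{[0,T)}N=\infty$,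 then this is a derivative blow-up: $$\limsup_{t\nearrow T}\bigl(\|(u_t,v_t)(t)\|_{L^\infty}+\|(u_x,v_x)(t)\|_{L^\infty}\bigr)=\infty.$$ -/

import Mathlib

open Set Filter Topology

noncomputable section

namespace DampedPSystem

/-- The pressure `p(u) = u^{-γ} / γ`. -/
def pressure (γ u : ℝ) : ℝ := u ^ (-γ) / γ

/-- `η(u) = ∫_u^∞ √(-p'(ξ)) dξ = 2/(γ-1) · u^{-(γ-1)/2}`. -/
def eta (γ u : ℝ) : ℝ := 2 / (γ - 1) * u ^ (-(γ - 1) / 2)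

/-- The Riemann invariant `r = v - η(u)` of a pair of functions of `x`. -/
def riemannR (γ : ℝ) (u v : ℝ → ℝ) (x : ℝ) : ℝ := v x - eta γ (u x)

/-- The Riemann invariant `s = v + η(u)` of a pair of functions of `x`. -/
def riemannS (γ : ℝ) (u v : ℝ → ℝ) (x : ℝ) : ℝ := v x + eta γ (u x)

/-- The space `C¹_b(ℝ)`: continuously differentiable, bounded, with bounded derivative. -/
def IsC1b (f : ℝ → ℝ) : Prop :=
  ContDiff ℝ 1 f ∧ (∃ C : ℝ, ∀ x, |f x| ≤ C) ∧ ∃ C : ℝ, ∀ x, |deriv f x| ≤ C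

/-- The class `X_{m,δ}`: pairs in `C¹_b(ℝ) × C¹_b(ℝ)` with `‖u‖_∞ + ‖v‖_∞ ≤ m` and `u ≥ δ`.
The bound on the sum of the two suprema is written as `|u x| + |v y| ≤ m` for all `x`, `y`. -/
structure InX (m δ : ℝ) (u v : ℝ → ℝ) : Prop where
  u_c1b : IsC1b u
  v_c1b : IsC1b v
  norm_le : ∀ x y, |u x| + |v y| ≤ m
  le_u : ∀ x, δ ≤ u x

/-- The partial derivative in `t`; it is one-sided at `t = 0`. -/
def dt (f : ℝ → ℝ → ℝ) (t x : ℝ) : ℝ := derivWithin (fun τ => f τ x) (Ici 0) t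

/-- The partial derivative in `x`. -/
def dx (f : ℝ → ℝ → ℝ) (t x : ℝ) : ℝ := deriv (fun y => f t y) x

/-- The strip `[0,T) × ℝ`, for `T ∈ [0,∞]`. -/
def strip (T : ENNReal) : Set (ℝ × ℝ) := {q | 0 ≤ q.1 ∧ ENNReal.ofReal q.1 < T}

/-- `(u,v)` (as functions of `t`, then `x`) is a `C¹` solution on `[0,T) × ℝ`, with `u > 0`, of
`u_t - v_x = 0`, `v_t + p(u)_x = -λ/(1+t)^μ · v`, `(u,v)(0,·) = (u₀,v₀)`. -/
structure IsClassicalSolution (γ lam μ : ℝ) (u₀ v₀ : ℝ → ℝ) (T : ENNReal) (u v : ℝ → ℝ → ℝ) :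
    Prop where
  u_c1 : ContDiffOn ℝ 1 (fun q : ℝ × ℝ => u q.1 q.2) (strip T)
  v_c1 : ContDiffOn ℝ 1 (fun q : ℝ × ℝ => v q.1 q.2) (strip T)
  u_pos : ∀ t x, (t, x) ∈ strip T → 0 < u t x
  mass : ∀ t x, (t, x) ∈ strip T → dt u t x - dx v t x = 0
  momentum : ∀ t x, (t, x) ∈ strip T →
    dt v t x + dx (fun τ y => pressure γ (u τ y)) t x = -(lam / (1 + t) ^ μ) * v t x
  u_init : ∀ x, u 0 x = u₀ x
  v_init : ∀ x, v 0 x = v₀ x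

/-- The sup norms over `x` of `u, v, u_t, v_t, u_x, v_x` and `p'(u)` are bounded uniformly for
`t ∈ [0,T)`. -/
def NormsBounded (γ : ℝ) (T : ENNReal) (u v : ℝ → ℝ → ℝ) : Prop :=
  ∃ C : ℝ, ∀ t x, (t, x) ∈ strip T →
    |u t x| ≤ C ∧ |v t x| ≤ C ∧ |dt u t x| ≤ C ∧ |dt v t x| ≤ C ∧
      |dx u t x| ≤ C ∧ |dx v t x| ≤ C ∧ |deriv (pressure γ) (u t x)| ≤ C

/-- A solution on `[0,T)` in the class in which the Cauchy problem is posed: a `C¹` solution whose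
norms are bounded on `[0,T')` for each `T' < T`. -/
structure IsSolution (γ lam μ : ℝ) (u₀ v₀ : ℝ → ℝ) (T : ENNReal) (u v : ℝ → ℝ → ℝ) :
    Prop where
  classical : IsClassicalSolution γ lam μ u₀ v₀ T u v
  bounded : ∀ T' < T, NormsBounded γ T' u v

/-- The lifespan `T* ∈ [0,∞]` for the data `(u₀,v₀)`: the supremum of the `T > 0` such that there
is a `C¹` solution on `[0,T)` whose norms are bounded on the whole of `[0,T)`. -/
def lifespan (γ lam μ : ℝ) (u₀ v₀ : ℝ → ℝ) : ENNReal :=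
  sSup {T | 0 < T ∧ ∃ u v : ℝ → ℝ → ℝ,
    IsClassicalSolution γ lam μ u₀ v₀ T u v ∧ NormsBounded γ T u v}

/-- `limsup_{t ↗ T} (‖(u_t,v_t)(t)‖_∞ + ‖(u_x,v_x)(t)‖_∞) = ∞`. -/
def DerivativeBlowUp (T : ENNReal) (u v : ℝ → ℝ → ℝ) : Prop :=
  ∀ M : ℝ, ∀ T₀ < T, ∃ t x, (t, x) ∈ strip T ∧ T₀ ≤ ENNReal.ofReal t ∧
    M < |dt u t x| + |dt v t x| + |dx u t x| + |dx v t x|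

end DampedPSystem

end

noncomputable section

namespace DampedPSystem

/-! ### Calculus on the space-time strip. -/

section Strip

variable {T : ENNReal} {f : ℝ → ℝ → ℝ}

/-! Write `R_ε = v - ε η(u)` and `b(t) = λ/(1+t)^μ`. Each `R_ε` is transported with speed `-ε c(u)`
and source `-b v = -b (R_1 + R_{-1})/2`.

Bounds. Subtract from `R_ε` the same invariant of the homogeneous solution `(u₋, -v₋ E(t))`, where
`E' = -b E`. The two differences `f_ε` satisfy `f_ε' = -(b/2)(f_ε + f_{-ε})` along their own
characteristics, so a common bound on both cannot grow (`abs_riemann_add_le`). Letting one of the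
two points tend to `-∞` in the hypothesis bounds them initially by some `D < η(u₋)/2`. Hence `|η(u)
- η(u₋)| ≤ D` for all time, which keeps `η(u)` between positive constants and `v` bounded
(`exists_uniform_bounds`).

Blow-up. For `w = ∂ₓR_ε` and `β = (γ+1)/4`, the weight `u^{-β}` and the corrector `(b/2) Q(u)`
remove all other derivatives from the equation along a characteristic, leaving a Riccati equation
with coefficients controlled by the bounds on `u` (`hasDerivWithinAt_weighted`). A sufficiently
negative initial slope then limits the lifespan (`riccati_time_le`, `exists_lifespan_bound`). Since
`w` is merely continuous, its equation comes from difference quotients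
(`hasDerivWithinAt_dx_riemann`). -/

theorem strip_eq (T : ENNReal) :
    strip T = (Ici (0 : ℝ) ×ˢ univ) ∩ {q : ℝ × ℝ | ENNReal.ofReal q.1 < T} := by
  ext q; simp [strip]

theorem isOpen_ofReal_lt (T : ENNReal) : IsOpen {t : ℝ | ENNReal.ofReal t < T} :=
  isOpen_lt ENNReal.continuous_ofReal continuous_const

theorem uniqueDiffOn_strip (T : ENNReal) : UniqueDiffOn ℝ (strip T) := by
  rw [strip_eq]
  exact ((uniqueDiffOn_Ici 0).prod uniqueDiffOn_univ).inter
    ((isOpen_ofReal_lt T).preimage continuous_fst)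

theorem mem_strip_of_le {t T' x : ℝ} (h0 : 0 ≤ t) (h : t ≤ T') (hT : ENNReal.ofReal T' < T) :
    (t, x) ∈ strip T :=
  ⟨h0, (ENNReal.ofReal_le_ofReal h).trans_lt hT⟩

/-- Common source of both partial derivatives and of the chain rule along characteristics.
Derivatives are taken within the strip because it contains its boundary `t = 0`. -/
theorem hasDerivWithinAt_path (hf : ContDiffOn ℝ 1 (fun q : ℝ × ℝ => f q.1 q.2) (strip T))
    {I : Set ℝ} {g X : ℝ → ℝ} {t g' X' : ℝ} (ht : t ∈ I)
    (hI : ∀ τ ∈ I, (g τ, X τ) ∈ strip T)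
    (hg : HasDerivWithinAt g g' I t) (hX : HasDerivWithinAt X X' I t) :
    HasDerivWithinAt (fun τ => f (g τ) (X τ))
      (fderivWithin ℝ (fun q : ℝ × ℝ => f q.1 q.2) (strip T) (g t, X t) (g', X')) I t := by
  have h := ((hf.differentiableOn one_ne_zero) (g t, X t) (hI t ht)).hasFDerivWithinAt
  exact h.comp_hasDerivWithinAt_of_eq t (hg.prodMk hX) hI rfl

theorem hasDerivAt_dx_aux (hf : ContDiffOn ℝ 1 (fun q : ℝ × ℝ => f q.1 q.2) (strip T))
    {t x : ℝ} (h : (t, x) ∈ strip T) :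
    HasDerivAt (f t) (fderivWithin ℝ (fun q : ℝ × ℝ => f q.1 q.2) (strip T) (t, x) (0, 1)) x := by
  rw [← hasDerivWithinAt_univ]
  exact hasDerivWithinAt_path hf (g := fun _ => t) (X := id) (mem_univ x) (fun _ _ => h)
    (hasDerivWithinAt_const _ _ _) (hasDerivWithinAt_id _ _)

theorem dx_eq_fderivWithin (hf : ContDiffOn ℝ 1 (fun q : ℝ × ℝ => f q.1 q.2) (strip T))
    {t x : ℝ} (h : (t, x) ∈ strip T) :
    dx f t x = fderivWithin ℝ (fun q : ℝ × ℝ => f q.1 q.2) (strip T) (t, x) (0, 1) :=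
  (hasDerivAt_dx_aux hf h).deriv

theorem hasDerivAt_dx (hf : ContDiffOn ℝ 1 (fun q : ℝ × ℝ => f q.1 q.2) (strip T))
    {t x : ℝ} (h : (t, x) ∈ strip T) : HasDerivAt (f t) (dx f t x) x := by
  rw [dx_eq_fderivWithin hf h]; exact hasDerivAt_dx_aux hf h

theorem hasDerivWithinAt_dt_aux (hf : ContDiffOn ℝ 1 (fun q : ℝ × ℝ => f q.1 q.2) (strip T))
    {t x : ℝ} (h : (t, x) ∈ strip T) :
    HasDerivWithinAt (fun τ => f τ x)
      (fderivWithin ℝ (fun q : ℝ × ℝ => f q.1 q.2) (strip T) (t, x) (1, 0)) (Ici 0) t := by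
  have := hasDerivWithinAt_path hf (g := id) (X := fun _ => x)
    (I := Ici 0 ∩ {τ : ℝ | ENNReal.ofReal τ < T}) (t := t) h (fun _ hτ => hτ)
    (hasDerivWithinAt_id _ _) (hasDerivWithinAt_const _ _ _)
  exact this.mono_of_mem_nhdsWithin
    (inter_mem self_mem_nhdsWithin (mem_nhdsWithin_of_mem_nhds ((isOpen_ofReal_lt T).mem_nhds h.2)))

theorem dt_eq_fderivWithin (hf : ContDiffOn ℝ 1 (fun q : ℝ × ℝ => f q.1 q.2) (strip T))
    {t x : ℝ} (h : (t, x) ∈ strip T) :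
    dt f t x = fderivWithin ℝ (fun q : ℝ × ℝ => f q.1 q.2) (strip T) (t, x) (1, 0) :=
  (hasDerivWithinAt_dt_aux hf h).derivWithin (uniqueDiffOn_Ici 0 t h.1)

theorem hasDerivWithinAt_dt (hf : ContDiffOn ℝ 1 (fun q : ℝ × ℝ => f q.1 q.2) (strip T))
    {t x : ℝ} (h : (t, x) ∈ strip T) :
    HasDerivWithinAt (fun τ => f τ x) (dt f t x) (Ici 0) t := by
  rw [dt_eq_fderivWithin hf h]; exact hasDerivWithinAt_dt_aux hf h

/-- The chain rule along a curve `τ ↦ (τ, X τ)` in the strip. -/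
theorem hasDerivWithinAt_curve (hf : ContDiffOn ℝ 1 (fun q : ℝ × ℝ => f q.1 q.2) (strip T))
    {I : Set ℝ} {X : ℝ → ℝ} {t X' : ℝ} (ht : t ∈ I) (hI : ∀ τ ∈ I, (τ, X τ) ∈ strip T)
    (hX : HasDerivWithinAt X X' I t) :
    HasDerivWithinAt (fun τ => f τ (X τ)) (dt f t (X t) + X' * dx f t (X t)) I t := by
  have h := hasDerivWithinAt_path hf (g := fun τ => τ) ht hI (hasDerivWithinAt_id t I) hX
  convert h using 1
  rw [dt_eq_fderivWithin hf (hI t ht), dx_eq_fderivWithin hf (hI t ht)]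
  have : ((1 : ℝ), X') = (1, 0) + X' • ((0 : ℝ), (1 : ℝ)) := by simp
  rw [this, map_add, map_smul]; simp

theorem continuousOn_dx (hf : ContDiffOn ℝ 1 (fun q : ℝ × ℝ => f q.1 q.2) (strip T)) :
    ContinuousOn (fun q : ℝ × ℝ => dx f q.1 q.2) (strip T) := by
  have := (hf.continuousOn_fderivWithin (uniqueDiffOn_strip T) le_rfl).clm_apply
    (continuousOn_const (c := ((0 : ℝ), (1 : ℝ))))
  exact this.congr fun q hq => dx_eq_fderivWithin hf hq

theorem contDiff_slice (hf : ContDiffOn ℝ 1 (fun q : ℝ × ℝ => f q.1 q.2) (strip T))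
    {t : ℝ} (h0 : 0 ≤ t) (h : ENNReal.ofReal t < T) : ContDiff ℝ 1 (f t) := by
  rw [← contDiffOn_univ]
  exact hf.comp (f := fun y => (t, y)) (by fun_prop) fun y _ => ⟨h0, h⟩

/-- A bound on the `x`-derivative gives a Lipschitz bound on each time slice. -/
theorem abs_sub_le_of_dx_le (hf : ContDiffOn ℝ 1 (fun q : ℝ × ℝ => f q.1 q.2) (strip T))
    {t C : ℝ} (h0 : 0 ≤ t) (h : ENNReal.ofReal t < T) (hC : ∀ x, |dx f t x| ≤ C) (x y : ℝ) :
    |f t y - f t x| ≤ C * |y - x| :=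
  convex_univ.norm_image_sub_le_of_norm_hasDerivWithin_le
    (fun _ _ => (hasDerivAt_dx hf ⟨h0, h⟩).hasDerivWithinAt) (fun z _ => hC z)
    (mem_univ x) (mem_univ y)

end Strip

/-! ### Global integral curves. -/

/-- A vector field which is bounded and Lipschitz in space, uniformly in time, has an integral curve
on the whole time interval through each of its points. -/
theorem exists_integralCurve {c : ℝ → ℝ → ℝ} {T C L : ℝ} (hC : 0 ≤ C) (hL : 0 ≤ L)
    (hcont : ∀ x, ContinuousOn (fun t => c t x) (Icc 0 T))
    (hb : ∀ t ∈ Icc 0 T, ∀ x, |c t x| ≤ C)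
    (hlip : ∀ t ∈ Icc 0 T, ∀ x y, |c t y - c t x| ≤ L * |y - x|)
    {t₀ : ℝ} (ht₀ : t₀ ∈ Icc 0 T) (x₀ : ℝ) :
    ∃ X : ℝ → ℝ, X t₀ = x₀ ∧ ∀ t ∈ Icc 0 T, HasDerivWithinAt X (c t (X t)) (Icc 0 T) t := by
  lift C to NNReal using hC
  lift L to NNReal using hL
  have hT : 0 ≤ T := ht₀.1.trans ht₀.2
  -- With speed at most `C`, a curve cannot leave the ball of radius `C * T` within time `T`, so
  -- Picard–Lindelöf covers the whole interval.
  have : IsPicardLindelof c (⟨t₀, ht₀⟩ : Icc 0 T) x₀ (C * ⟨T, hT⟩) 0 C L := by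
    refine ⟨fun t ht => ?_, fun x _ => hcont x, fun t ht x _ => hb t ht x, ?_⟩
    · exact (LipschitzWith.of_dist_le_mul fun x y => by
        rw [Real.dist_eq, Real.dist_eq]; exact hlip t ht y x).lipschitzOnWith
    · simp only [NNReal.coe_zero, sub_zero]
      refine mul_le_mul_of_nonneg_left (max_le ?_ ?_) C.2
      · change T - t₀ ≤ T; linarith [ht₀.1]
      · exact ht₀.2
  exact this.exists_eq_forall_mem_Icc_hasDerivWithinAt₀

/-! ### Sound speed, pressure and `η`. -/

/-- The sound speed `c(u) = √(-p'(u)) = u^{-(γ+1)/2}`. -/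
def sound (γ u : ℝ) : ℝ := u ^ (-(γ + 1) / 2)

/-- The damping coefficient `λ / (1+t)^μ`. -/
def damping (lam μ t : ℝ) : ℝ := lam / (1 + t) ^ μ

/-- The Riemann invariant `v - ε η(u)`; it is `r` for `ε = 1` and `s` for `ε = -1`. -/
def riemann (γ ε : ℝ) (u v : ℝ → ℝ → ℝ) (t x : ℝ) : ℝ := v t x - ε * eta γ (u t x)

section Calculus

variable {γ u : ℝ}

theorem sound_pos (hu : 0 < u) : 0 < sound γ u := Real.rpow_pos_of_pos hu _

theorem sound_sq (hu : 0 < u) : sound γ u ^ 2 = u ^ (-γ - 1) := by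
  rw [sound, ← Real.rpow_natCast, ← Real.rpow_mul hu.le]; congr 1; push_cast; ring

theorem hasDerivAt_eta (hγ : 1 < γ) (hu : 0 < u) : HasDerivAt (eta γ) (-sound γ u) u := by
  have h := (Real.hasDerivAt_rpow_const (p := -(γ - 1) / 2) (Or.inl hu.ne')).const_mul
    (2 / (γ - 1))
  refine h.congr_deriv ?_
  have e : -(γ - 1) / 2 - 1 = -(γ + 1) / 2 := by ring
  have h1 : γ - 1 ≠ 0 := by linarith
  rw [e, sound]; field_simp

theorem hasDerivAt_pressure (hγ : 1 < γ) (hu : 0 < u) :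
    HasDerivAt (pressure γ) (-sound γ u ^ 2) u := by
  have h := (Real.hasDerivAt_rpow_const (p := -γ) (Or.inl hu.ne')).div_const γ
  refine h.congr_deriv ?_
  rw [sound_sq hu]; field_simp

theorem hasDerivAt_sound (hu : 0 < u) :
    HasDerivAt (sound γ) (-(γ + 1) / 2 * (sound γ u / u)) u := by
  have h := Real.hasDerivAt_rpow_const (p := -(γ + 1) / 2) (Or.inl hu.ne')
  refine h.congr_deriv ?_
  rw [Real.rpow_sub_one hu.ne', sound]

theorem eta_pos (hγ : 1 < γ) (hu : 0 < u) : 0 < eta γ u :=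
  mul_pos (div_pos two_pos (by linarith)) (Real.rpow_pos_of_pos hu _)

theorem eta_anti (hγ : 1 < γ) {w : ℝ} (hu : 0 < u) (huw : u ≤ w) : eta γ w ≤ eta γ u := by
  have : 0 < 2 / (γ - 1) := div_pos two_pos (by linarith)
  exact mul_le_mul_of_nonneg_left (Real.rpow_le_rpow_of_nonpos hu huw (by linarith)) this.le

theorem eta_strictAnti (hγ : 1 < γ) {w : ℝ} (hu : 0 < u) (huw : u < w) : eta γ w < eta γ u := by
  have : 0 < 2 / (γ - 1) := div_pos two_pos (by linarith)
  exact mul_lt_mul_of_pos_left (Real.rpow_lt_rpow_of_neg hu huw (by linarith)) this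

/-- `η` maps `(0,∞)` onto `(0,∞)`. -/
theorem exists_eta_eq (hγ : 1 < γ) {E : ℝ} (hE : 0 < E) : ∃ w > 0, eta γ w = E := by
  have h1 : γ - 1 ≠ 0 := by linarith
  have h0 : 0 < γ - 1 := by linarith
  refine ⟨(E * (γ - 1) / 2) ^ (-2 / (γ - 1)), Real.rpow_pos_of_pos (by positivity) _, ?_⟩
  rw [eta, ← Real.rpow_mul (by positivity)]
  have : -2 / (γ - 1) * (-(γ - 1) / 2) = 1 := by field_simp
  rw [this, Real.rpow_one]; field_simp

/-- A bound on `p'(u)` bounds every negative power of `u`. -/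
theorem rpow_neg_le_of_deriv_pressure_le (hγ : 1 < γ) {C q : ℝ} (hq : 0 ≤ q) (hu : 0 < u)
    (h : |deriv (pressure γ) u| ≤ C) : u ^ (-q) ≤ C ^ (q / (γ + 1)) := by
  rw [(hasDerivAt_pressure hγ hu).deriv, abs_neg, abs_of_nonneg (sq_nonneg _), sound_sq hu] at h
  have h1 : γ + 1 ≠ 0 := by linarith
  have e : u ^ (-q) = (u ^ (-γ - 1)) ^ (q / (γ + 1)) := by
    rw [← Real.rpow_mul hu.le]; congr 1; field_simp; ring
  rw [e]
  exact Real.rpow_le_rpow (Real.rpow_nonneg hu.le _) h (div_nonneg hq (by linarith))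

end Calculus

/-! ### Riemann invariants and their bounds on compact time intervals. -/

section Equations

variable {γ lam μ : ℝ} {u₀ v₀ : ℝ → ℝ} {T : ENNReal} {u v : ℝ → ℝ → ℝ}

namespace IsClassicalSolution

variable (h : IsClassicalSolution γ lam μ u₀ v₀ T u v)
include h

theorem contDiffOn_rpow (k : ℝ) :
    ContDiffOn ℝ 1 (fun q : ℝ × ℝ => u q.1 q.2 ^ k) (strip T) :=
  h.u_c1.rpow_const_of_ne fun q hq => (h.u_pos q.1 q.2 hq).ne'

theorem contDiffOn_sound :
    ContDiffOn ℝ 1 (fun q : ℝ × ℝ => sound γ (u q.1 q.2)) (strip T) :=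
  h.contDiffOn_rpow _

theorem contDiffOn_riemann (ε : ℝ) :
    ContDiffOn ℝ 1 (fun q : ℝ × ℝ => riemann γ ε u v q.1 q.2) (strip T) :=
  h.v_c1.sub (contDiffOn_const.mul (contDiffOn_const.mul (h.contDiffOn_rpow _)))

theorem dx_sound {t x : ℝ} (hq : (t, x) ∈ strip T) :
    dx (fun τ y => sound γ (u τ y)) t x =
      -(γ + 1) / 2 * (sound γ (u t x) / u t x) * dx u t x :=
  ((hasDerivAt_sound (h.u_pos t x hq)).comp x (hasDerivAt_dx h.u_c1 hq)).deriv

theorem dx_pressure (hγ : 1 < γ) {t x : ℝ} (hq : (t, x) ∈ strip T) :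
    dx (fun τ y => pressure γ (u τ y)) t x = -sound γ (u t x) ^ 2 * dx u t x :=
  ((hasDerivAt_pressure hγ (h.u_pos t x hq)).comp x (hasDerivAt_dx h.u_c1 hq)).deriv

theorem dx_riemann (hγ : 1 < γ) (ε : ℝ) {t x : ℝ} (hq : (t, x) ∈ strip T) :
    dx (riemann γ ε u v) t x = dx v t x + ε * sound γ (u t x) * dx u t x := by
  have := (hasDerivAt_dx h.v_c1 hq).sub
    (((hasDerivAt_eta hγ (h.u_pos t x hq)).comp x (hasDerivAt_dx h.u_c1 hq)).const_mul ε)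
  refine this.deriv.trans ?_
  ring

theorem dt_riemann (hγ : 1 < γ) (ε : ℝ) {t x : ℝ} (hq : (t, x) ∈ strip T) :
    dt (riemann γ ε u v) t x = dt v t x + ε * sound γ (u t x) * dt u t x := by
  have := (hasDerivWithinAt_dt h.v_c1 hq).sub
    (((hasDerivAt_eta hγ (h.u_pos t x hq)).comp_hasDerivWithinAt t
      (hasDerivWithinAt_dt h.u_c1 hq)).const_mul ε)
  refine (this.derivWithin (uniqueDiffOn_Ici 0 t hq.1)).trans ?_
  ring

/-- The Riemann invariant is transported with speed `-ε c(u)`. -/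
theorem riemann_transport (hγ : 1 < γ) {ε : ℝ} (hε : ε ^ 2 = 1) {t x : ℝ}
    (hq : (t, x) ∈ strip T) :
    dt (riemann γ ε u v) t x + -ε * sound γ (u t x) * dx (riemann γ ε u v) t x =
      -damping lam μ t * v t x := by
  have h1 := h.mass t x hq
  have h2 := h.momentum t x hq
  rw [h.dx_pressure hγ hq] at h2
  rw [h.dt_riemann hγ ε hq, h.dx_riemann hγ ε hq, damping]
  linear_combination h2 + ε * sound γ (u t x) * h1 - sound γ (u t x) ^ 2 * dx u t x * hε

end IsClassicalSolution

/-- On a compact time interval the Riemann invariants, the sound speed and their `x`-derivatives are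
bounded. -/
theorem IsSolution.exists_bound (hγ : 1 < γ) (h : IsSolution γ lam μ u₀ v₀ T u v) {T₁ : ℝ}
    (hT : ENNReal.ofReal T₁ < T) :
    ∃ C, 0 ≤ C ∧ ∀ t ∈ Icc 0 T₁, ∀ x, |sound γ (u t x)| ≤ C ∧
      |dx (fun τ y => sound γ (u τ y)) t x| ≤ C ∧
      ∀ ε : ℝ, ε ^ 2 = 1 → |riemann γ ε u v t x| ≤ C ∧ |dx (riemann γ ε u v) t x| ≤ C := by
  -- The norms are bounded on half-open intervals only, so a later `T₂` is needed to include the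
  -- time `T₁`.
  obtain ⟨T₂, h12, h2⟩ := exists_between hT
  obtain ⟨C, hC⟩ := h.bounded T₂ h2
  have hγ1 : 0 < 2 / (γ - 1) := div_pos two_pos (by linarith)
  have hγ2 : 0 < (γ + 1) / 2 := by linarith
  let A : ℝ → ℝ := fun q => |C| ^ (q / (γ + 1))
  have hA : ∀ q, 0 ≤ A q := fun q => Real.rpow_nonneg (abs_nonneg _) _
  have hA1 := hA ((γ + 1) / 2)
  have hA2 := hA ((γ + 3) / 2)
  have hA3 := hA ((γ - 1) / 2)
  have hC0 := abs_nonneg C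
  refine ⟨A ((γ + 1) / 2) + (γ + 1) / 2 * A ((γ + 3) / 2) * |C| +
    (|C| + 2 / (γ - 1) * A ((γ - 1) / 2)) + (|C| + A ((γ + 1) / 2) * |C|), by positivity,
    fun t ht x => ?_⟩
  have hq : (t, x) ∈ strip T := mem_strip_of_le ht.1 ht.2 hT
  have hu := h.classical.u_pos t x hq
  obtain ⟨-, hv, -, -, hux, hvx, hp⟩ := hC t x (mem_strip_of_le ht.1 ht.2 h12)
  have hCC := le_abs_self C
  replace hv := hv.trans hCC
  replace hux := hux.trans hCC
  replace hvx := hvx.trans hCC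
  replace hp := hp.trans hCC
  have b1 : |sound γ (u t x)| ≤ A ((γ + 1) / 2) := by
    rw [abs_of_pos (sound_pos hu), sound, neg_div]
    exact rpow_neg_le_of_deriv_pressure_le hγ (by linarith) hu hp
  have b2 : |dx (fun τ y => sound γ (u τ y)) t x| ≤ (γ + 1) / 2 * A ((γ + 3) / 2) * |C| := by
    have e : sound γ (u t x) / u t x = u t x ^ (-((γ + 3) / 2)) := by
      rw [sound, ← Real.rpow_sub_one hu.ne']; congr 1; ring
    rw [h.classical.dx_sound hq, e, abs_mul, abs_mul, neg_div, abs_neg, abs_of_pos hγ2,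
      abs_of_nonneg (Real.rpow_nonneg hu.le _)]
    gcongr
    exact rpow_neg_le_of_deriv_pressure_le hγ (by linarith) hu hp
  have b3 : |eta γ (u t x)| ≤ 2 / (γ - 1) * A ((γ - 1) / 2) := by
    rw [abs_of_pos (eta_pos hγ hu), eta, neg_div]
    gcongr
    exact rpow_neg_le_of_deriv_pressure_le hγ (by linarith) hu hp
  have p1 : 0 ≤ (γ + 1) / 2 * A ((γ + 3) / 2) * |C| := by positivity
  have p2 : 0 ≤ 2 / (γ - 1) * A ((γ - 1) / 2) := by positivity
  have p3 : 0 ≤ A ((γ + 1) / 2) * |C| := by positivity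
  refine ⟨by linarith, by linarith, fun ε hε => ?_⟩
  have hε1 : |ε| = 1 := by
    rcases sq_eq_one_iff.mp hε with e | e <;> simp [e]
  constructor
  · have : |riemann γ ε u v t x| ≤ |v t x| + |ε * eta γ (u t x)| := abs_sub _ _
    rw [abs_mul, hε1, one_mul] at this
    linarith
  · have b4 : |sound γ (u t x)| * |dx u t x| ≤ A ((γ + 1) / 2) * |C| := by gcongr
    rw [h.classical.dx_riemann hγ ε hq]
    have := abs_add_le (dx v t x) (ε * sound γ (u t x) * dx u t x)
    rw [abs_mul, abs_mul, hε1, one_mul] at this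
    linarith

end Equations

/-! ### The damping coefficient. -/

section Damping

variable {lam μ t : ℝ}

theorem one_le_one_add_rpow (hμ : 0 ≤ μ) (ht : 0 ≤ t) : 1 ≤ (1 + t) ^ μ :=
  Real.one_le_rpow (by linarith) hμ

theorem damping_nonneg (hlam : 0 ≤ lam) (ht : 0 ≤ t) : 0 ≤ damping lam μ t :=
  div_nonneg hlam (Real.rpow_nonneg (by linarith) _)

theorem damping_le (hlam : 0 ≤ lam) (hμ : 0 ≤ μ) (ht : 0 ≤ t) : damping lam μ t ≤ lam :=
  div_le_self hlam (one_le_one_add_rpow hμ ht)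

theorem hasDerivAt_damping (ht : 0 ≤ t) :
    HasDerivAt (damping lam μ) (-(lam * μ) * (1 + t) ^ (-μ - 1)) t := by
  have h1 : 0 < 1 + t := by linarith
  have h := (((hasDerivAt_id t).const_add 1).rpow_const (p := -μ) (Or.inl h1.ne')).const_mul lam
  refine (h.congr_deriv (by simp only [id]; ring)).congr_of_eventuallyEq ?_
  filter_upwards [lt_mem_nhds (show -1 < t by linarith)] with τ hτ
  rw [damping, id, Real.rpow_neg (by linarith), div_eq_mul_inv]

theorem abs_deriv_damping_le (hlam : 0 ≤ lam) (hμ : 0 ≤ μ) (ht : 0 ≤ t) :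
    |-(lam * μ) * (1 + t) ^ (-μ - 1)| ≤ lam * μ := by
  rw [abs_mul, abs_neg, abs_of_nonneg (mul_nonneg hlam hμ),
    abs_of_nonneg (Real.rpow_nonneg (by linarith) _)]
  exact mul_le_of_le_one_right (mul_nonneg hlam hμ)
    (Real.rpow_le_one_of_one_le_of_nonpos (by linarith) (by linarith))

/-- The solution of `E' = -λ/(1+t)^μ E`, `E(0) = 1`. -/
theorem exists_dampingFactor (hlam : 0 ≤ lam) (μ : ℝ) :
    ∃ E : ℝ → ℝ, E 0 = 1 ∧ (∀ t ≥ 0, |E t| ≤ 1) ∧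
      ∀ t ≥ 0, HasDerivAt E (-damping lam μ t * E t) t := by
  -- The absolute value makes the integrand continuous on all of `ℝ` without changing it for `t ≥
  -- 0`.
  have hc : Continuous fun t : ℝ => damping lam μ |t| :=
    continuous_const.div
      ((continuous_const.add continuous_abs).rpow_const fun t =>
        Or.inl (add_pos_of_pos_of_nonneg one_pos (abs_nonneg t)).ne')
      fun t => (Real.rpow_pos_of_pos (add_pos_of_pos_of_nonneg one_pos (abs_nonneg t)) _).ne'
  refine ⟨fun t => Real.exp (-∫ τ in (0 : ℝ)..t, damping lam μ |τ|), by simp, fun t ht => ?_,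
    fun t ht => ?_⟩
  · rw [Real.abs_exp, Real.exp_le_one_iff, neg_nonpos]
    exact intervalIntegral.integral_nonneg ht fun τ _ => damping_nonneg hlam (abs_nonneg τ)
  · have := (hc.integral_hasStrictDerivAt 0 t).hasDerivAt.neg.exp
    refine this.congr_deriv ?_
    rw [abs_of_nonneg (show (0 : ℝ) ≤ t from ht), mul_comm]; rfl

end Damping

/-! ### Relaxation and the maximum principle. -/

/-- If `g' = -b (g + h)` and both `g` and `h` are bounded by `S`, then `g` is strictly below `S` as
soon as it is so initially, with an explicit gap. -/
theorem le_of_relaxation {g h b : ℝ → ℝ} {t κ S D : ℝ} (ht : 0 ≤ t)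
    (hg : ∀ τ ∈ Icc 0 t, HasDerivWithinAt g (-b τ * (g τ + h τ)) (Icc 0 t) τ)
    (hb : ∀ τ ∈ Icc 0 t, 0 ≤ b τ ∧ b τ ≤ κ) (hgS : ∀ τ ∈ Icc 0 t, g τ ≤ S)
    (hhS : ∀ τ ∈ Icc 0 t, -S ≤ h τ) (h0 : g 0 ≤ D) :
    g t ≤ S - (S - D) * Real.exp (-(κ * t)) := by
  -- This product is nondecreasing: `κ (S - g) + b (g + h) ≥ b (S - g) + b (g + h) = b (S + h) ≥ 0`.
  have hd : ∀ τ ∈ Icc 0 t, HasDerivWithinAt (fun τ => (S - g τ) * Real.exp (κ * τ))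
      (Real.exp (κ * τ) * (κ * (S - g τ) + b τ * (g τ + h τ))) (Icc 0 t) τ := fun τ hτ => by
    have h1 := ((hasDerivWithinAt_const τ (Icc 0 t) S).sub (hg τ hτ)).mul
      ((hasDerivAt_id τ).const_mul κ).exp.hasDerivWithinAt
    refine h1.congr_deriv ?_
    simp only [id, Pi.sub_apply]; ring
  have hmono := monotoneOn_of_hasDerivWithinAt_nonneg (convex_Icc 0 t)
    (fun τ hτ => (hd τ hτ).continuousWithinAt)
    (fun τ hτ => (hd τ (interior_subset hτ)).mono interior_subset) fun τ hτ => by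
      have hτ := interior_subset hτ
      refine mul_nonneg (Real.exp_pos _).le ?_
      nlinarith [hb τ hτ, hgS τ hτ, hhS τ hτ,
        mul_nonneg (sub_nonneg.2 (hb τ hτ).2) (sub_nonneg.2 (hgS τ hτ)),
        mul_nonneg (hb τ hτ).1 (by linarith [hhS τ hτ] : 0 ≤ h τ + S)]
  have := hmono (left_mem_Icc.2 ht) (right_mem_Icc.2 ht) ht
  simp only [mul_zero, Real.exp_zero, mul_one] at this
  have h2 : (S - D) * Real.exp (-(κ * t)) ≤ S - g t := by
    rw [Real.exp_neg, ← div_eq_mul_inv, div_le_iff₀ (Real.exp_pos _)]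
    linarith
  linarith

/-- The equation is odd in `(g, h)`, so the one-sided bound applies to `(-g, -h)` too. -/
theorem abs_le_of_relaxation {g h b : ℝ → ℝ} {t κ S D : ℝ} (ht : 0 ≤ t)
    (hg : ∀ τ ∈ Icc 0 t, HasDerivWithinAt g (-b τ * (g τ + h τ)) (Icc 0 t) τ)
    (hb : ∀ τ ∈ Icc 0 t, 0 ≤ b τ ∧ b τ ≤ κ) (hgS : ∀ τ ∈ Icc 0 t, |g τ| ≤ S)
    (hhS : ∀ τ ∈ Icc 0 t, |h τ| ≤ S) (h0 : |g 0| ≤ D) :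
    |g t| ≤ S - (S - D) * Real.exp (-(κ * t)) := by
  refine abs_le'.2 ⟨le_of_relaxation ht hg hb (fun τ hτ => (abs_le.1 (hgS τ hτ)).2)
    (fun τ hτ => (abs_le.1 (hhS τ hτ)).1) (abs_le.1 h0).2, ?_⟩
  refine le_of_relaxation (g := fun τ => -g τ) (h := fun τ => -h τ) ht
    (fun τ hτ => (hg τ hτ).neg.congr_deriv (by ring)) hb
    (fun τ hτ => neg_le.1 (abs_le.1 (hgS τ hτ)).1)
    (fun τ hτ => neg_le_neg (abs_le.1 (hhS τ hτ)).2) (neg_le.1 (abs_le.1 h0).1)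

/-- A bound improving itself by a fixed fraction of its distance to `D` is at most `D`. -/
theorem le_of_forall_upperBound {P : Set ℝ} (hP : BddAbove P) {D θ : ℝ} (hθ : 0 < θ)
    (h : ∀ S ∈ upperBounds P, D ≤ S → S - (S - D) * θ ∈ upperBounds P) : D ∈ upperBounds P := by
  rcases P.eq_empty_or_nonempty with rfl | hne
  · simp
  have hS : max D (sSup P) ∈ upperBounds P := fun p hp => le_max_of_le_right (le_csSup hP hp)
  have h1 : sSup P ≤ _ := csSup_le hne (h _ hS (le_max_left _ _))
  have h2 : sSup P ≤ D := by
    by_contra! hlt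
    rw [max_eq_right hlt.le] at h1
    nlinarith
  exact fun p hp => (le_csSup hP hp).trans h2

namespace IsSolution

variable {γ lam μ : ℝ} {u₀ v₀ : ℝ → ℝ} {T : ENNReal} {u v : ℝ → ℝ → ℝ}

/-- Through each point passes a characteristic of speed `-ε c(u)`. -/
theorem exists_characteristic (h : IsSolution γ lam μ u₀ v₀ T u v) (hγ : 1 < γ) {T₁ : ℝ}
    (hT : ENNReal.ofReal T₁ < T) {ε : ℝ} (hε : ε ^ 2 = 1) {t₀ : ℝ} (ht₀ : t₀ ∈ Icc 0 T₁)
    (x₀ : ℝ) :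
    ∃ X : ℝ → ℝ, X t₀ = x₀ ∧
      ∀ t ∈ Icc 0 T₁, HasDerivWithinAt X (-ε * sound γ (u t (X t))) (Icc 0 T₁) t := by
  obtain ⟨C, hC0, hC⟩ := h.exists_bound hγ hT
  have hε1 : |(-ε)| = 1 := by rcases sq_eq_one_iff.mp hε with e | e <;> simp [e]
  refine exists_integralCurve (c := fun t x => -ε * sound γ (u t x)) hC0 hC0 (fun x => ?_)
    (fun t ht x => ?_) (fun t ht x y => ?_) ht₀ x₀
  · exact continuousOn_const.mul (h.classical.contDiffOn_sound.continuousOn.comp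
      (f := fun t => (t, x)) (by fun_prop) fun t ht => mem_strip_of_le ht.1 ht.2 hT)
  · rw [abs_mul, hε1, one_mul]; exact (hC t ht x).1
  · rw [← mul_sub, abs_mul, hε1, one_mul]
    exact abs_sub_le_of_dx_le (f := fun t x => sound γ (u t x)) h.classical.contDiffOn_sound ht.1
      ((ENNReal.ofReal_le_ofReal ht.2).trans_lt hT) (fun x => (hC t ht x).2.1) x y

/-- Maximum principle: the bound on the pair of shifted Riemann invariants does not grow. -/
theorem abs_riemann_add_le (h : IsSolution γ lam μ u₀ v₀ T u v) (hγ : 1 < γ) (hlam : 0 ≤ lam)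
    (hμ : 0 ≤ μ) {w : ℝ → ℝ} {k D : ℝ}
    (hw : ∀ t ≥ 0, HasDerivAt w (-damping lam μ t * w t) t)
    (h0 : ∀ ε : ℝ, ε ^ 2 = 1 → ∀ x, |riemann γ ε u v 0 x + w 0 + ε * k| ≤ D)
    {t : ℝ} (ht : 0 ≤ t) (hT : ENNReal.ofReal t < T) {ε : ℝ} (hε : ε ^ 2 = 1) (x : ℝ) :
    |riemann γ ε u v t x + w t + ε * k| ≤ D := by
  let f : ℝ → ℝ → ℝ → ℝ := fun ε t x => riemann γ ε u v t x + w t + ε * k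
  -- Suprema over `ℝ` need not be attained, so no point of first contact is available. Instead, both
  -- families are bounded together by `S`, and every such bound is improved by a fixed fraction of
  -- `S - D`.
  let P : Set ℝ := {p | ∃ ε : ℝ, ε ^ 2 = 1 ∧ ∃ τ ∈ Icc 0 t, ∃ x, p = |f ε τ x|}
  have hbdd : BddAbove P := by
    obtain ⟨C, -, hC⟩ := h.exists_bound hγ hT
    obtain ⟨W, hW⟩ := isCompact_Icc.exists_bound_of_continuousOn (s := Icc 0 t) (f := w)
      fun τ hτ => (hw τ hτ.1).continuousAt.continuousWithinAt
    refine ⟨C + W + |k|, ?_⟩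
    rintro _ ⟨ε, hε, τ, hτ, x, rfl⟩
    have hε1 : |ε| = 1 := by rcases sq_eq_one_iff.mp hε with e | e <;> simp [e]
    have h1 := abs_add_le (riemann γ ε u v τ x + w τ) (ε * k)
    have h2 := abs_add_le (riemann γ ε u v τ x) (w τ)
    rw [abs_mul, hε1, one_mul] at h1
    have h3 := ((hC τ hτ x).2.2 ε hε).1
    have h4 : |w τ| ≤ W := hW τ hτ
    change |riemann γ ε u v τ x + w τ + ε * k| ≤ _
    linarith
  refine le_of_forall_upperBound hbdd (Real.exp_pos (-(lam / 2 * t))) ?_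
    ⟨ε, hε, t, ⟨ht, le_rfl⟩, x, rfl⟩
  rintro S hS hDS _ ⟨ε, hε, t₁, ht₁, x, rfl⟩
  have hT₁ := (ENNReal.ofReal_le_ofReal ht₁.2).trans_lt hT
  obtain ⟨X, hX, hX'⟩ := h.exists_characteristic hγ hT₁ hε (t₀ := t₁) ⟨ht₁.1, le_rfl⟩ x
  have hin : ∀ τ ∈ Icc 0 t₁, (τ, X τ) ∈ strip T := fun τ hτ => mem_strip_of_le hτ.1 hτ.2 hT₁
  have hε' : (-ε) ^ 2 = 1 := by rwa [neg_sq]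
  -- Since `f ε + f (-ε) = 2 (v + w)`, the source `-b (v + w)` has the relaxation form with
  -- coefficient `b/2`. The other family is only evaluated on this characteristic, where `S` bounds
  -- it.
  have key := abs_le_of_relaxation (g := fun τ => f ε τ (X τ)) (h := fun τ => f (-ε) τ (X τ))
    (b := fun τ => damping lam μ τ / 2) (κ := lam / 2) (S := S) (D := D) ht₁.1 (fun τ hτ => ?_)
    (fun τ hτ => ?_) (fun τ hτ => hS ⟨ε, hε, τ, ⟨hτ.1, hτ.2.trans ht₁.2⟩, _, rfl⟩)
    (fun τ hτ => hS ⟨-ε, hε', τ, ⟨hτ.1, hτ.2.trans ht₁.2⟩, _, rfl⟩) (h0 ε hε _)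
  · simp only [hX] at key
    -- The gap at time `t₁` is at least the one at time `t`, which makes the improvement uniform
    -- over `P`.
    refine key.trans (sub_le_sub_left (mul_le_mul_of_nonneg_left (Real.exp_le_exp.2 ?_)
      (sub_nonneg.2 hDS)) _)
    exact neg_le_neg (mul_le_mul_of_nonneg_left ht₁.2 (by positivity))
  · have h1 := hasDerivWithinAt_curve (h.classical.contDiffOn_riemann ε) hτ hin (hX' τ hτ)
    rw [h.classical.riemann_transport hγ hε (hin τ hτ)] at h1
    refine ((h1.add (hw τ hτ.1).hasDerivWithinAt).add_const (ε * k)).congr_deriv ?_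
    simp only [f, riemann]; ring
  · have h1 := damping_nonneg (μ := μ) hlam hτ.1
    have h2 := damping_le hlam hμ hτ.1
    constructor <;> linarith

end IsSolution

/-! ### Uniform bounds on `u` and `v`. -/

/-- The constants controlling `u` and `v` in terms of the class `X_{m,δ}` of the data. -/
theorem exists_uniform_bounds {γ lam μ : ℝ} (hγ : 1 < γ) (hlam : 0 ≤ lam) (hμ : 0 ≤ μ) {m δ : ℝ}
    (hm : 0 < m) (hδ : 0 < δ) :
    ∃ m₁ > 0, ∃ δ₁ > 0, ∀ (u₀ v₀ : ℝ → ℝ) (uminus vminus : ℝ), InX m δ u₀ v₀ →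
      0 < uminus → Tendsto u₀ atBot (𝓝 uminus) → Tendsto v₀ atBot (𝓝 vminus) →
      (∃ D < 1 / (γ - 1) * uminus ^ (-(γ - 1) / 2), ∀ x y,
          |riemannS γ u₀ v₀ x + riemannR γ u₀ v₀ y| ≤ D) →
      ∀ (T : ENNReal) (u v : ℝ → ℝ → ℝ), IsSolution γ lam μ u₀ v₀ T u v →
        ∀ t : ℝ, 0 ≤ t → ENNReal.ofReal t < T → InX m₁ δ₁ (u t) (v t) := by
  have hηδ := eta_pos hγ hδ
  have hηm := eta_pos hγ hm
  -- It will turn out that `η(u₋)/2 < η(u) < 3 η(u₋)/2` with `δ ≤ u₋ ≤ m`; as `η` decreases, these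
  -- choices put `u` in `[δ₁, M]`.
  obtain ⟨δ₁, hδ₁, hδe⟩ := exists_eta_eq hγ (E := 2 * eta γ δ) (by positivity)
  obtain ⟨M, hM, hMe⟩ := exists_eta_eq hγ (E := eta γ m / 2) (by positivity)
  refine ⟨M + (eta γ δ + m), by positivity, δ₁, hδ₁, ?_⟩
  rintro u₀ v₀ um vm hX hum hu hv ⟨D, hD, hsum⟩ T u v h t ht hT
  obtain ⟨E, hE0, hE1, hE'⟩ := exists_dampingFactor hlam μ
  have hηum : Tendsto (fun x => eta γ (u₀ x)) atBot (𝓝 (eta γ um)) :=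
    (hasDerivAt_eta hγ hum).continuousAt.tendsto.comp hu
  have hDη : D < eta γ um / 2 := by
    refine hD.trans_eq ?_
    rw [eta]; ring
  have humδ : δ ≤ um := ge_of_tendsto' hu hX.le_u
  have humm : um ≤ m := le_of_tendsto' hu fun x =>
    (le_abs_self _).trans ((le_add_of_nonneg_right (abs_nonneg _)).trans (hX.norm_le x x))
  have hvm : |vm| ≤ m := le_of_tendsto' hv.abs fun x =>
    (le_add_of_nonneg_left (abs_nonneg _)).trans (hX.norm_le x x)
  have hη1 := eta_anti hγ hδ humδ
  have hη2 := eta_anti hγ hum humm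
  -- For `r` the argument of `s` tends to `-∞` in the hypothesis, and for `s` that of `r`.
  have h0 : ∀ ε : ℝ, ε ^ 2 = 1 → ∀ x, |riemann γ ε u v 0 x + vm * E 0 + ε * eta γ um| ≤ D := by
    intro ε hε x
    have hu0 := h.classical.u_init x
    have hv0 := h.classical.v_init x
    simp only [riemann, hu0, hv0, hE0, mul_one]
    rcases sq_eq_one_iff.mp hε with rfl | rfl
    · refine le_of_tendsto' (((hv.add hηum).add_const (v₀ x - eta γ (u₀ x))).abs.congr'
        (Eventually.of_forall fun y => rfl) |>.trans ?_) (fun y => hsum y x)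
      rw [show v₀ x - 1 * eta γ (u₀ x) + vm + 1 * eta γ um =
        vm + eta γ um + (v₀ x - eta γ (u₀ x)) by ring]
    · refine le_of_tendsto' (((hv.sub hηum).const_add (v₀ x + eta γ (u₀ x))).abs.congr'
        (Eventually.of_forall fun y => rfl) |>.trans ?_) (fun y => hsum x y)
      rw [show v₀ x - -1 * eta γ (u₀ x) + vm + -1 * eta γ um =
        v₀ x + eta γ (u₀ x) + (vm - eta γ um) by ring]
  have hw : ∀ t ≥ 0, HasDerivAt (fun t => vm * E t) (-damping lam μ t * (vm * E t)) t :=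
    fun t ht => ((hE' t ht).const_mul vm).congr_deriv (by ring)
  have key : ∀ x, (v t x) ≤ D + m ∧ -(D + m) ≤ v t x ∧ |eta γ (u t x) - eta γ um| ≤ D := by
    intro x
    -- The half-sum of the two bounded quantities is `v + v₋ E`, and their half-difference is `η(u)
    -- - η(u₋)`, up to sign.
    have k1 := abs_le.1 (h.abs_riemann_add_le hγ hlam hμ hw h0 ht hT (ε := 1) (by norm_num) x)
    have k2 := abs_le.1 (h.abs_riemann_add_le hγ hlam hμ hw h0 ht hT (ε := -1) (by norm_num) x)
    simp only [riemann] at k1 k2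
    have k3 : |vm * E t| ≤ m := by
      rw [abs_mul]
      exact (mul_le_of_le_one_right (abs_nonneg _) (hE1 t ht)).trans hvm
    have k4 := abs_le.1 k3
    refine ⟨by linarith, by linarith, abs_le.2 ⟨by linarith, by linarith⟩⟩
  have hpos : ∀ x, 0 < u t x := fun x => h.classical.u_pos t x ⟨ht, hT⟩
  have hlow : ∀ x, δ₁ ≤ u t x := fun x => by
    by_contra! hlt
    have := eta_strictAnti hγ (hpos x) hlt
    have := (abs_le.1 (key x).2.2).2
    linarith
  have hup : ∀ x, u t x ≤ M := fun x => by
    by_contra! hlt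
    have := eta_strictAnti hγ hM hlt
    have := (abs_le.1 (key x).2.2).1
    linarith
  have hub : ∀ x, |u t x| ≤ M := fun x => by rw [abs_of_pos (hpos x)]; exact hup x
  have hvb : ∀ x, |v t x| ≤ eta γ δ + m := fun x =>
    abs_le.2 ⟨by linarith [(key x).2.1], by linarith [(key x).1]⟩
  obtain ⟨T₂, h12, h2⟩ := exists_between hT
  obtain ⟨C, hC⟩ := h.bounded T₂ h2
  exact ⟨⟨contDiff_slice h.classical.u_c1 ht hT, ⟨M, hub⟩,
      ⟨C, fun x => (hC t x ⟨ht, h12⟩).2.2.2.2.1⟩⟩,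
    ⟨contDiff_slice h.classical.v_c1 ht hT, ⟨_, hvb⟩,
      ⟨C, fun x => (hC t x ⟨ht, h12⟩).2.2.2.2.2.1⟩⟩,
    fun x y => add_le_add (hub x) (hvb y), hlow⟩

/-! ### Riccati comparison. -/

/-- A supersolution of a Riccati equation which starts far enough below does not live long. -/
theorem riccati_time_le {Z Z' : ℝ → ℝ} {t κ C K : ℝ} (ht : 0 ≤ t) (hκ : 0 < κ) (hK : 0 < K)
    (hKC : C ≤ κ / 2 * K ^ 2) (hZ : ∀ τ ∈ Icc 0 t, HasDerivWithinAt Z (Z' τ) (Icc 0 t) τ)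
    (hZ' : ∀ τ ∈ Icc 0 t, Z' τ ≤ -κ * Z τ ^ 2 + C) (h0 : Z 0 ≤ -K) : t ≤ 2 / (κ * K) := by
  have hc : ContinuousOn Z (Icc 0 t) := fun τ hτ => (hZ τ hτ).continuousWithinAt
  -- The level `-K` is a barrier: there `Z' ≤ -κ K² / 2 < 0`.
  have hle : ∀ τ ∈ Icc 0 t, Z τ ≤ -K := by
    refine fun τ hτ => image_le_of_deriv_right_lt_deriv_boundary (f' := Z') (B := fun _ => -K)
      (B' := fun _ => 0) hc (fun x hx => ?_) h0 (fun x => hasDerivAt_const x _)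
      (fun x hx he => ?_) hτ
    · exact (hZ x (Ico_subset_Icc_self hx)).mono_of_mem_nhdsWithin (Icc_mem_nhdsGE_of_mem hx)
    · have := hZ' x (Ico_subset_Icc_self hx)
      rw [he] at this
      have : 0 < κ * K ^ 2 := by positivity
      linarith
  have hneg : ∀ τ ∈ Icc 0 t, Z τ < 0 := fun τ hτ => (hle τ hτ).trans_lt (by linarith)
  -- Below the barrier `C ≤ κ Z² / 2`, so `1/Z` grows at rate at least `κ/2`. It starts above `-1/K`
  -- or at it and stays negative, which limits `t`.
  have hd : ∀ τ ∈ Icc 0 t, HasDerivWithinAt (fun τ => (Z τ)⁻¹ - κ / 2 * τ)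
      (-Z' τ / Z τ ^ 2 - κ / 2) (Icc 0 t) τ := fun τ hτ =>
    ((hZ τ hτ).inv (hneg τ hτ).ne).sub
      (((hasDerivWithinAt_id τ _).const_mul (κ / 2)).congr_deriv (mul_one _))
  have hmono := monotoneOn_of_hasDerivWithinAt_nonneg (convex_Icc 0 t)
    (fun τ hτ => (hd τ hτ).continuousWithinAt)
    (fun τ hτ => (hd τ (interior_subset hτ)).mono interior_subset) fun τ hτ => by
      have hτ := interior_subset hτ
      have h2 : 0 < Z τ ^ 2 := sq_pos_of_neg (hneg τ hτ)
      rw [sub_nonneg, le_div_iff₀ h2]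
      have h3 : K ^ 2 ≤ Z τ ^ 2 := by nlinarith [hle τ hτ]
      nlinarith [hZ' τ hτ]
  have h1 := hmono (left_mem_Icc.2 ht) (right_mem_Icc.2 ht) ht
  have h2 : (Z t)⁻¹ < 0 := inv_lt_zero.2 (hneg t ⟨ht, le_rfl⟩)
  have h3 : -K⁻¹ ≤ (Z 0)⁻¹ := by
    rw [neg_inv]
    exact (inv_le_inv_of_neg (by linarith) (hneg 0 ⟨le_rfl, ht⟩)).2 h0
  simp only [mul_zero, sub_zero] at h1
  have h4 : κ / 2 * t ≤ K⁻¹ := by linarith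
  rw [le_div_iff₀ (by positivity)]
  have h5 := mul_le_mul_of_nonneg_right h4 hK.le
  rw [inv_mul_cancel₀ hK.ne'] at h5
  linarith

/-! ### Equation for the slope of a Riemann invariant. -/

/-- If the increments `h ↦ g(·, h)` of a function solve an equation whose right-hand side has a
dominated limit after division by `h`, then the derivative in `h` solves the limit equation. -/
theorem hasDerivWithinAt_of_tendsto_slope {t₁ C : ℝ} {g G : ℝ → ℝ → ℝ} {w W : ℝ → ℝ}
    (hg : ∀ n > 0, ∀ τ ∈ Icc 0 t₁, HasDerivWithinAt (g n) (G n τ) (Icc 0 t₁) τ)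
    (hG : ∀ n > 0, ContinuousOn (G n) (Icc 0 t₁))
    (hGb : ∀ n > 0, ∀ τ ∈ Icc 0 t₁, |G n τ| ≤ C)
    (hglim : ∀ τ ∈ Icc 0 t₁, Tendsto (fun n => g n τ) (𝓝[>] 0) (𝓝 (w τ)))
    (hGlim : ∀ τ ∈ Icc 0 t₁, Tendsto (fun n => G n τ) (𝓝[>] 0) (𝓝 (W τ)))
    (hW : ContinuousOn W (Icc 0 t₁)) :
    ∀ τ ∈ Icc 0 t₁, HasDerivWithinAt w (W τ) (Icc 0 t₁) τ := by
  intro τ₀ hτ₀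
  have h01 : 0 ≤ t₁ := hτ₀.1.trans hτ₀.2
  have hsub : ∀ τ ∈ Icc 0 t₁, Icc 0 τ ⊆ Icc 0 t₁ := fun τ hτ => Icc_subset_Icc_right hτ.2
  -- The limit is taken in the integrated equations by dominated convergence; continuity of `W` then
  -- allows differentiation.
  have hint : ∀ τ ∈ Icc 0 t₁, w τ = w 0 + ∫ σ in (0 : ℝ)..τ, W σ := by
    intro τ hτ
    have hsubI : uIoc (0 : ℝ) τ ⊆ Icc 0 t₁ := by
      rw [uIoc_of_le hτ.1]; exact Ioc_subset_Icc_self.trans (hsub τ hτ)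
    have e1 : ∀ n > 0, ∫ σ in (0 : ℝ)..τ, G n σ = g n τ - g n 0 := fun n hn =>
      intervalIntegral.integral_eq_sub_of_hasDerivAt_of_le hτ.1
        (fun σ hσ => ((hg n hn σ (hsub τ hτ hσ)).continuousWithinAt).mono (hsub τ hτ))
        (fun σ hσ => (hg n hn σ (hsub τ hτ (Ioo_subset_Icc_self hσ))).hasDerivAt
          (mem_of_superset (Ioo_mem_nhds hσ.1 hσ.2) (Ioo_subset_Icc_self.trans (hsub τ hτ))))
        (((hG n hn).mono (hsub τ hτ)).intervalIntegrable_of_Icc hτ.1)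
    have l1 : Tendsto (fun n => ∫ σ in (0 : ℝ)..τ, G n σ) (𝓝[>] 0)
        (𝓝 (∫ σ in (0 : ℝ)..τ, W σ)) := by
      refine intervalIntegral.tendsto_integral_filter_of_dominated_convergence (fun _ => C) ?_ ?_
        intervalIntegrable_const (Eventually.of_forall fun σ hσ => hGlim σ (hsubI hσ))
      · filter_upwards [self_mem_nhdsWithin] with n hn
        exact ((hG n hn).mono hsubI).aestronglyMeasurable measurableSet_uIoc
      · filter_upwards [self_mem_nhdsWithin] with n hn
        exact Eventually.of_forall fun σ hσ => hGb n hn σ (hsubI hσ)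
    have l2 : Tendsto (fun n => g n τ - g n 0) (𝓝[>] 0) (𝓝 (w τ - w 0)) :=
      (hglim τ hτ).sub (hglim 0 ⟨le_rfl, h01⟩)
    have l3 := tendsto_nhds_unique (l1.congr' (by
      filter_upwards [self_mem_nhdsWithin] with n hn using e1 n hn)) l2
    linarith
  let V : ℝ → ℝ := IccExtend h01 ((Icc 0 t₁).domRestrict W)
  have hV : Continuous V := (continuousOn_iff_continuous_domRestrict.1 hW).Icc_extend'
  have hVW : ∀ σ ∈ Icc 0 t₁, V σ = W σ := fun σ hσ => IccExtend_of_mem h01 _ hσ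
  have hd : HasDerivWithinAt (fun τ => w 0 + ∫ σ in (0 : ℝ)..τ, V σ) (W τ₀) (Icc 0 t₁) τ₀ := by
    rw [← hVW τ₀ hτ₀]
    exact ((hV.integral_hasStrictDerivAt 0 τ₀).hasDerivAt.const_add _).hasDerivWithinAt
  have he : ∀ τ ∈ Icc 0 t₁, w τ = w 0 + ∫ σ in (0 : ℝ)..τ, V σ := fun τ hτ => by
    rw [hint τ hτ, intervalIntegral.integral_congr fun σ hσ => ?_]
    rw [uIcc_of_le hτ.1] at hσ
    exact (hVW σ (hsub τ hτ hσ)).symm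
  exact hd.congr he (he τ₀ hτ₀)

theorem tendsto_quotient_of_hasDerivAt {f : ℝ → ℝ} {f' x : ℝ} (h : HasDerivAt f f' x) :
    Tendsto (fun n => (f (x + n) - f x) / n) (𝓝[>] 0) (𝓝 f') := by
  have := (hasDerivAt_iff_tendsto_slope_zero.1 h).mono_left
    (nhdsWithin_mono 0 fun n (hn : 0 < n) => hn.ne')
  exact this.congr fun n => by rw [smul_eq_mul]; ring

namespace IsSolution

variable {γ lam μ : ℝ} {u₀ v₀ : ℝ → ℝ} {T : ENNReal} {u v : ℝ → ℝ → ℝ}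

/-- The equation for the derivative of a Riemann invariant along its characteristic, for solutions
which are only once continuously differentiable. -/
theorem hasDerivWithinAt_dx_riemann (h : IsSolution γ lam μ u₀ v₀ T u v) (hγ : 1 < γ)
    (hlam : 0 ≤ lam) (hμ : 0 ≤ μ) {t₁ : ℝ} (hT : ENNReal.ofReal t₁ < T) {ε : ℝ} (hε : ε ^ 2 = 1)
    {X : ℝ → ℝ}
    (hX : ∀ t ∈ Icc 0 t₁, HasDerivWithinAt X (-ε * sound γ (u t (X t))) (Icc 0 t₁) t) :
    ∀ t ∈ Icc 0 t₁, HasDerivWithinAt (fun t => dx (riemann γ ε u v) t (X t))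
      (ε * dx (fun τ y => sound γ (u τ y)) t (X t) * dx (riemann γ ε u v) t (X t)
        - damping lam μ t * dx v t (X t)) (Icc 0 t₁) t := by
  obtain ⟨C, hC0, hC⟩ := h.exists_bound hγ hT
  have hcl := h.classical
  have hε1 : |ε| = 1 := by rcases sq_eq_one_iff.mp hε with e | e <;> simp [e]
  have hε' : (-ε) ^ 2 = 1 := by rwa [neg_sq]
  have hXc : ContinuousOn X (Icc 0 t₁) := fun t ht => (hX t ht).continuousWithinAt
  have hin : ∀ n, ∀ t ∈ Icc 0 t₁, (t, X t + n) ∈ strip T :=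
    fun n t ht => mem_strip_of_le ht.1 ht.2 hT
  have hin0 : ∀ t ∈ Icc 0 t₁, (t, X t) ∈ strip T := fun t ht => mem_strip_of_le ht.1 ht.2 hT
  have hlt : ∀ t ∈ Icc 0 t₁, ENNReal.ofReal t < T := fun t ht => (hin 0 t ht).2
  have hcomp : ∀ {f : ℝ → ℝ → ℝ},
      ContinuousOn (fun q : ℝ × ℝ => f q.1 q.2) (strip T) → ∀ n,
      ContinuousOn (fun t => f t (X t + n)) (Icc 0 t₁) := fun hf n =>
    hf.comp (f := fun t => (t, X t + n)) (continuousOn_id.prodMk (hXc.add continuousOn_const))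
      (hin n)
  have hcomp0 : ∀ {f : ℝ → ℝ → ℝ},
      ContinuousOn (fun q : ℝ × ℝ => f q.1 q.2) (strip T) →
      ContinuousOn (fun t => f t (X t)) (Icc 0 t₁) := fun hf => by
    simpa using hcomp hf 0
  have hdamp : ContinuousOn (damping lam μ) (Icc 0 t₁) := fun t ht =>
    (hasDerivAt_damping ht.1).continuousAt.continuousWithinAt
  have hcs := hcl.contDiffOn_sound
  have hr := hcl.contDiffOn_riemann ε
  -- The available bounds concern the invariants, and `v` inherits its Lipschitz constant as their
  -- mean.
  have hv2 : ∀ t x, v t x = (riemann γ ε u v t x + riemann γ (-ε) u v t x) / 2 := fun t x => by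
    simp only [riemann]; ring
  have hvlip : ∀ t ∈ Icc 0 t₁, ∀ x y, |v t y - v t x| ≤ C * |y - x| := fun t ht x y => by
    have e1 := abs_le.1 (abs_sub_le_of_dx_le hr ht.1 (hlt t ht)
      (fun z => ((hC t ht z).2.2 ε hε).2) x y)
    have e2 := abs_le.1 (abs_sub_le_of_dx_le (hcl.contDiffOn_riemann (-ε)) ht.1 (hlt t ht)
      (fun z => ((hC t ht z).2.2 (-ε) hε').2) x y)
    rw [hv2 t y, hv2 t x]
    exact abs_le.2 ⟨by linarith, by linarith⟩
  -- The characteristic is compared with its translate by `n`. The translate is not characteristic,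
  -- and its speed error, the increment of `c`, produces the term `ε c_x w` in the limit without any
  -- second derivative.
  refine hasDerivWithinAt_of_tendsto_slope (C := C * C + lam * C)
    (g := fun n t => (riemann γ ε u v t (X t + n) - riemann γ ε u v t (X t)) / n)
    (G := fun n t => ε * ((sound γ (u t (X t + n)) - sound γ (u t (X t))) / n)
        * dx (riemann γ ε u v) t (X t + n)
      - damping lam μ t * ((v t (X t + n) - v t (X t)) / n)) ?_ ?_ ?_ ?_ ?_ ?_
  · intro n _ t ht
    have h1 := hasDerivWithinAt_curve hr ht (hin n) ((hX t ht).add_const n)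
    have h2 := hasDerivWithinAt_curve hr ht hin0 (hX t ht)
    refine ((h1.sub h2).div_const n).congr_deriv ?_
    have e1 := hcl.riemann_transport hγ hε (hin n t ht)
    have e2 := hcl.riemann_transport hγ hε (hin0 t ht)
    rw [e2, eq_sub_of_add_eq e1]
    ring
  · intro n _
    exact ((continuousOn_const.mul (((hcomp (f := fun τ y => sound γ (u τ y)) hcs.continuousOn
      n).sub (hcomp0 (f := fun τ y => sound γ (u τ y)) hcs.continuousOn)).div_const n)).mul
      (hcomp (continuousOn_dx hr) n)).sub
      (hdamp.mul (((hcomp hcl.v_c1.continuousOn n).sub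
        (hcomp0 hcl.v_c1.continuousOn)).div_const n))
  · intro n hn t ht
    have hq : ∀ {a : ℝ}, |a| ≤ C * |X t + n - X t| → |a / n| ≤ C := fun ha => by
      rw [add_sub_cancel_left] at ha
      rw [abs_div, div_le_iff₀ (abs_pos.2 hn.ne')]; exact ha
    have b1 := hq (abs_sub_le_of_dx_le (f := fun τ y => sound γ (u τ y)) hcs ht.1 (hlt t ht)
      (fun z => (hC t ht z).2.1) (X t) (X t + n))
    have b2 := hq (hvlip t ht (X t) (X t + n))
    refine (abs_sub _ _).trans (add_le_add ?_ ?_)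
    · rw [abs_mul, abs_mul, hε1, one_mul]
      exact mul_le_mul b1 ((hC t ht _).2.2 ε hε).2 (abs_nonneg _) hC0
    · rw [abs_mul, abs_of_nonneg (damping_nonneg hlam ht.1)]
      exact mul_le_mul (damping_le hlam hμ ht.1) b2 (abs_nonneg _) hlam
  · intro t ht
    exact tendsto_quotient_of_hasDerivAt (hasDerivAt_dx hr (hin0 t ht))
  · intro t ht
    have hshift : Tendsto (fun n => dx (riemann γ ε u v) t (X t + n)) (𝓝[>] 0)
        (𝓝 (dx (riemann γ ε u v) t (X t))) := by
      have hc : Continuous fun y => dx (riemann γ ε u v) t y := by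
        rw [← continuousOn_univ]
        exact (continuousOn_dx hr).comp (f := fun y => (t, y)) (by fun_prop)
          fun y _ => ⟨ht.1, hlt t ht⟩
      have := (hc.comp (continuous_const_add (X t))).tendsto 0
      simp only [Function.comp_def, add_zero] at this
      exact this.mono_left nhdsWithin_le_nhds
    exact (((tendsto_quotient_of_hasDerivAt (hasDerivAt_dx
      (f := fun τ y => sound γ (u τ y)) hcs (hin0 t ht))).const_mul ε).mul hshift).sub
      ((tendsto_quotient_of_hasDerivAt (hasDerivAt_dx hcl.v_c1 (hin0 t ht))).const_mul _)
  · exact ((continuousOn_const.mul (hcomp0 (continuousOn_dx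
      (f := fun τ y => sound γ (u τ y)) hcs))).mul (hcomp0 (continuousOn_dx hr))).sub
      (hdamp.mul (hcomp0 (continuousOn_dx hcl.v_c1)))

end IsSolution

theorem exists_antiderivative_rpow_neg (β : ℝ) :
    ∃ Q : ℝ → ℝ, ∀ u > 0, HasDerivAt Q (u ^ (-β)) u := by
  -- The logarithmic case; for `β = (γ+1)/4` it is `γ = 3`.
  by_cases hβ : β = 1
  · subst hβ
    exact ⟨Real.log, fun u hu => (Real.hasDerivAt_log (ne_of_gt hu)).congr_deriv
      (Real.rpow_neg_one u).symm⟩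
  · have h1 : 1 - β ≠ 0 := sub_ne_zero.2 (Ne.symm hβ)
    refine ⟨fun u => u ^ (1 - β) / (1 - β), fun u hu =>
      ((Real.hasDerivAt_rpow_const (p := 1 - β) (Or.inl (ne_of_gt hu))).div_const _).congr_deriv ?_⟩
    rw [show 1 - β - 1 = -β by ring]; field_simp

/-! ### Riccati equation along characteristics and blow-up. -/

section Blowup

variable {γ lam μ : ℝ} {u₀ v₀ : ℝ → ℝ} {T : ENNReal} {u v : ℝ → ℝ → ℝ}

/-- Along a characteristic the weighted derivative
`Z = u^{-(γ+1)/4} ∂ₓ(v - ε η(u)) + (a/2) Q(u)`, with `Q' = u^{-(γ+1)/4}`, solves a Riccati equation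
whose coefficients involve only `u`, not its derivatives. -/
theorem IsSolution.hasDerivWithinAt_weighted (h : IsSolution γ lam μ u₀ v₀ T u v) (hγ : 1 < γ)
    (hlam : 0 ≤ lam) (hμ : 0 ≤ μ) {t₁ : ℝ} (hT : ENNReal.ofReal t₁ < T) {ε : ℝ} (hε : ε ^ 2 = 1)
    {β : ℝ} (hβ : β = (γ + 1) / 4) {Q : ℝ → ℝ} (hQ : ∀ u > 0, HasDerivAt Q (u ^ (-β)) u)
    {X : ℝ → ℝ}
    (hX : ∀ t ∈ Icc 0 t₁, HasDerivWithinAt X (-ε * sound γ (u t (X t))) (Icc 0 t₁) t)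
    {Y : ℝ → ℝ} (hY : Y = fun t => u t (X t) ^ (-β) * dx (riemann γ ε u v) t (X t)) :
    ∀ t ∈ Icc 0 t₁, HasDerivWithinAt (fun t => Y t + damping lam μ t / 2 * Q (u t (X t)))
      (-(β * u t (X t) ^ (β - 1)) * Y t ^ 2 - damping lam μ t / 2 * Y t
        + -(lam * μ) * (1 + t) ^ (-μ - 1) / 2 * Q (u t (X t))) (Icc 0 t₁) t := by
  intro t ht
  have hin : ∀ t ∈ Icc 0 t₁, (t, X t) ∈ strip T := fun t ht => mem_strip_of_le ht.1 ht.2 hT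
  have hq := hin t ht
  have hpos := h.classical.u_pos t _ hq
  have hU := hasDerivWithinAt_curve h.classical.u_c1 ht hin (hX t ht)
  have hw := h.hasDerivWithinAt_dx_riemann hγ hlam hμ hT hε hX t ht
  have hP := hU.rpow_const (p := -β) (Or.inl hpos.ne')
  have hQU := (hQ _ hpos).comp_hasDerivWithinAt t hU
  have ha := (hasDerivAt_damping (lam := lam) (μ := μ) ht.1).hasDerivWithinAt (s := Icc 0 t₁)
  subst hY
  -- Along the curve `u' = v_x - ε c u_x`, while `w = v_x + ε c u_x`. Hence `ε c_x = -(β/u)(w - u')`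
  -- and `v_x = (w + u')/2`: the weight cancels `β w u'/u`, and `(b/2) Q(u)` absorbs `-(b/2) u^{-β}
  -- u'`.
  refine ((hP.mul hw).add ((ha.div_const 2).mul hQU)).congr_deriv ?_
  simp only [Function.comp_apply]
  have e1 : u t (X t) ^ (-β - 1) = u t (X t) ^ (-β) / u t (X t) := Real.rpow_sub_one hpos.ne' _
  have e2 : u t (X t) ^ (β - 1) * u t (X t) ^ (-β) = (u t (X t))⁻¹ := by
    rw [← Real.rpow_add hpos, ← Real.rpow_neg_one]; congr 1; ring
  have e3 : -(β * u t (X t) ^ (β - 1)) *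
      (u t (X t) ^ (-β) * dx (riemann γ ε u v) t (X t)) ^ 2 =
        -β * ((u t (X t))⁻¹ * u t (X t) ^ (-β) * dx (riemann γ ε u v) t (X t) ^ 2) := by
    rw [← e2]; ring
  have e4 : dt u t (X t) = dx v t (X t) := sub_eq_zero.1 (h.classical.mass t _ hq)
  rw [e3, e1, e4, h.classical.dx_sound hq, h.classical.dx_riemann hγ ε hq]
  generalize u t (X t) ^ (-β) = P
  rw [hβ]
  field_simp
  ring

/-- Solutions with `u` confined to `[d, M]` and with one steeply decreasing Riemann invariant live
no longer than a time depending only on the constants. -/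
theorem exists_lifespan_bound (hγ : 1 < γ) (hlam : 0 ≤ lam) (hμ : 0 ≤ μ) {d M : ℝ} (hd : 0 < d) :
    ∃ K > 0, ∃ B ≥ 0, ∀ (u₀ v₀ : ℝ → ℝ) (T : ENNReal) (u v : ℝ → ℝ → ℝ),
      IsSolution γ lam μ u₀ v₀ T u v → (∀ t x, (t, x) ∈ strip T → u t x ∈ Icc d M) →
      ∀ ε : ℝ, ε ^ 2 = 1 → ∀ x₀, dx (riemann γ ε u v) 0 x₀ ≤ -K →
      ∀ t₁ : ℝ, 0 ≤ t₁ → ENNReal.ofReal t₁ < T → t₁ ≤ B := by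
  obtain ⟨β, hβ⟩ : ∃ β, β = (γ + 1) / 4 := ⟨_, rfl⟩
  have hβ0 : 0 < β := by rw [hβ]; linarith
  have hpos : ∀ w ∈ Icc d M, 0 < w := fun w hw => hd.trans_le hw.1
  have hcpow : ∀ p : ℝ, ContinuousOn (fun w : ℝ => w ^ p) (Icc d M) := fun p w hw =>
    (Real.continuousAt_rpow_const w p (Or.inl (hpos w hw).ne')).continuousWithinAt
  obtain ⟨Q, hQ⟩ := exists_antiderivative_rpow_neg β
  obtain ⟨k, hk, hkle⟩ := isCompact_Icc.exists_forall_le' (a := (0 : ℝ))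
    (continuousOn_const.mul (hcpow (β - 1)) : ContinuousOn (fun w => β * w ^ (β - 1)) (Icc d M))
    fun w hw => mul_pos hβ0 (Real.rpow_pos_of_pos (hpos w hw) _)
  obtain ⟨l, hl, hlle⟩ := isCompact_Icc.exists_forall_le' (a := (0 : ℝ)) (hcpow (-β))
    fun w hw => Real.rpow_pos_of_pos (hpos w hw) _
  obtain ⟨A, hA⟩ := isCompact_Icc.exists_bound_of_continuousOn (s := Icc d M) (f := Q)
    fun w hw => (hQ w (hpos w hw)).continuousAt.continuousWithinAt
  replace hA : ∀ w ∈ Icc d M, |Q w| ≤ |A| := fun w hw => (hA w hw).trans (le_abs_self A)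
  have hA0 := abs_nonneg A
  generalize |A| = A at hA hA0
  -- `L` bounds the corrector, `C` collects the terms left after absorbing into the square, and `K`
  -- gives `C = (k/8)(K - 1) ≤ (k/8) K²`, as the Riccati comparison with rate `k/4` requires.
  obtain ⟨L, hL⟩ : ∃ L, L = lam / 2 * A := ⟨_, rfl⟩
  obtain ⟨C, hC⟩ : ∃ C, C = k / 2 * L ^ 2 + lam ^ 2 / (8 * k) + lam * μ / 2 * A := ⟨_, rfl⟩
  obtain ⟨K, hK⟩ : ∃ K, K = 1 + 8 * C / k := ⟨_, rfl⟩
  have hL0 : 0 ≤ L := by rw [hL]; positivity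
  have hC0 : 0 ≤ C := by rw [hC]; positivity
  have hK1 : 1 ≤ K := by rw [hK]; exact le_add_of_nonneg_right (by positivity)
  have hK0 : 0 < K := by linarith
  refine ⟨(K + L) / l, by positivity, 2 / (k / 4 * K), by positivity, ?_⟩
  intro u₀ v₀ T u v h hu ε hε x₀ hx₀ t₁ ht₁ hT
  obtain ⟨X, hX0, hX⟩ := h.exists_characteristic hγ hT hε (t₀ := 0) ⟨le_rfl, ht₁⟩ x₀
  have hin : ∀ t ∈ Icc 0 t₁, u t (X t) ∈ Icc d M := fun t ht =>
    hu t _ (mem_strip_of_le ht.1 ht.2 hT)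
  have hq : ∀ t ∈ Icc 0 t₁, |damping lam μ t / 2 * Q (u t (X t))| ≤ L := fun t ht => by
    have h1 := damping_nonneg (μ := μ) hlam ht.1
    rw [abs_mul, abs_of_nonneg (by positivity), hL]
    have h2 := damping_le hlam hμ ht.1
    have h3 := hA _ (hin t ht)
    gcongr
  refine riccati_time_le (C := C) ht₁ (by positivity) hK0 ?_
    (h.hasDerivWithinAt_weighted hγ hlam hμ hT hε hβ hQ hX rfl) (fun t ht => ?_) ?_
  · have e : C = k / 8 * (K - 1) := by rw [hK]; field_simp; ring
    nlinarith
  · have hb := abs_le.1 (hq t ht)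
    have hk' : k ≤ β * u t (X t) ^ (β - 1) := hkle _ (hin t ht)
    have ha0 := damping_nonneg (μ := μ) hlam ht.1
    have ha1 := damping_le hlam hμ ht.1
    have hs : -(lam * μ) * (1 + t) ^ (-μ - 1) / 2 * Q (u t (X t)) ≤ lam * μ / 2 * A := by
      refine (le_abs_self _).trans ?_
      rw [abs_mul, abs_div, abs_two]
      have h1 := abs_deriv_damping_le hlam hμ ht.1
      have h2 := hA _ (hin t ht)
      gcongr
    generalize damping lam μ t / 2 * Q (u t (X t)) = q at hb ⊢
    generalize -(lam * μ) * (1 + t) ^ (-μ - 1) / 2 * Q (u t (X t)) = s at hs ⊢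
    generalize u t (X t) ^ (-β) * dx (riemann γ ε u v) t (X t) = y
    generalize β * u t (X t) ^ (β - 1) = b at hk' ⊢
    generalize damping lam μ t = a at ha0 ha1 ⊢
    -- Half of `k y²` absorbs the linear damping term. The other half controls `(k/4)(y + q)²` up to
    -- `(k/2) L²`.
    have i1 : k * y ^ 2 ≤ b * y ^ 2 := mul_le_mul_of_nonneg_right hk' (sq_nonneg y)
    have i2 : -(a / 2) * y ≤ k / 2 * y ^ 2 + lam ^ 2 / (8 * k) := by
      have j1 : -(a / 2) * y ≤ k / 2 * y ^ 2 + a ^ 2 / (8 * k) := by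
        have : k / 2 * y ^ 2 + a ^ 2 / (8 * k) + a / 2 * y =
            (2 * k * y + a) ^ 2 / (8 * k) := by field_simp; ring
        have : 0 ≤ (2 * k * y + a) ^ 2 / (8 * k) := by positivity
        linarith
      have j2 : a ^ 2 / (8 * k) ≤ lam ^ 2 / (8 * k) := by gcongr
      linarith
    have i3 : (y + q) ^ 2 ≤ 2 * y ^ 2 + 2 * L ^ 2 := by
      have : q ^ 2 ≤ L ^ 2 := sq_le_sq' hb.1 hb.2
      nlinarith [sq_nonneg (y - q)]
    have i4 := mul_le_mul_of_nonneg_left i3 (by positivity : 0 ≤ k / 4)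
    rw [hC]
    linarith
  · have hm : (0 : ℝ) ∈ Icc 0 t₁ := ⟨le_rfl, ht₁⟩
    have hb := (abs_le.1 (hq 0 hm)).2
    have hl' := hlle _ (hin 0 hm)
    have hKl : 0 < (K + L) / l := by positivity
    have : u 0 (X 0) ^ (-β) * dx (riemann γ ε u v) 0 (X 0) ≤ -(K + L) := by
      have e : l * ((K + L) / l) = K + L := by field_simp
      rw [hX0] at hl' ⊢
      nlinarith
    linarith

/-- If `u` and `v` stay bounded and `u` stays away from zero, then a breakdown is a blow-up of the
first derivatives. -/
theorem IsSolution.derivativeBlowUp (h : IsSolution γ lam μ u₀ v₀ T u v) (hγ : 1 < γ) {m₁ δ₁ : ℝ}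
    (hδ₁ : 0 < δ₁) (hX : ∀ t : ℝ, 0 ≤ t → ENNReal.ofReal t < T → InX m₁ δ₁ (u t) (v t))
    (hN : ¬ NormsBounded γ T u v) : DerivativeBlowUp T u v := by
  by_contra hB
  simp only [DerivativeBlowUp, not_forall, not_exists, not_and, not_lt] at hB
  obtain ⟨M, T₀, hT₀, hM⟩ := hB
  -- If the derivatives did not blow up, the solution class would bound the norms before `T₂`;
  -- afterwards the assumed derivative bound and the class `X_{m₁,δ₁}` would do so.
  obtain ⟨T₂, h02, h2⟩ := exists_between hT₀
  obtain ⟨C, hC⟩ := h.bounded T₂ h2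
  refine hN ⟨max C (max M (max m₁ (δ₁ ^ (-γ - 1)))), fun t x hq => ?_⟩
  rcases lt_or_ge (ENNReal.ofReal t) T₂ with hlt | hge
  · obtain ⟨h1, h2, h3, h4, h5, h6, h7⟩ := hC t x ⟨hq.1, hlt⟩
    exact ⟨le_max_of_le_left h1, le_max_of_le_left h2, le_max_of_le_left h3, le_max_of_le_left h4,
      le_max_of_le_left h5, le_max_of_le_left h6, le_max_of_le_left h7⟩
  · have hs := hM t x hq (h02.le.trans hge)
    have hx := hX t hq.1 hq.2
    have hn := hx.norm_le x x
    have hu := abs_nonneg (u t x)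
    have hv := abs_nonneg (v t x)
    have d1 := abs_nonneg (dt u t x)
    have d2 := abs_nonneg (dt v t x)
    have d3 := abs_nonneg (dx u t x)
    have d4 := abs_nonneg (dx v t x)
    have toM : ∀ {a : ℝ}, a ≤ M → a ≤ max C (max M (max m₁ (δ₁ ^ (-γ - 1)))) := fun ha =>
      le_max_of_le_right (le_max_of_le_left ha)
    have tom : ∀ {a : ℝ}, a ≤ m₁ → a ≤ max C (max M (max m₁ (δ₁ ^ (-γ - 1)))) := fun ha =>
      le_max_of_le_right (le_max_of_le_right (le_max_of_le_left ha))
    refine ⟨tom (by linarith), tom (by linarith), toM (by linarith), toM (by linarith),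
      toM (by linarith), toM (by linarith), ?_⟩
    have hpos : 0 < u t x := hδ₁.trans_le (hx.le_u x)
    rw [(hasDerivAt_pressure hγ hpos).deriv, abs_neg, abs_of_nonneg (sq_nonneg _), sound_sq hpos]
    exact le_max_of_le_right (le_max_of_le_right (le_max_of_le_right
      (Real.rpow_le_rpow_of_nonpos hδ₁ (hx.le_u x) (by linarith))))

end Blowup

end DampedPSystem

end

/-! ### The theorem. -/

theorem theorem2p1 (γ lam μ : ℝ) (hγ : 1 < γ)
    (hdamp : (μ = 1 ∧ 0 ≤ lam ∧ lam ≤ 2) ∨ (1 < μ ∧ 0 ≤ lam))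
    (m δ : ℝ) (hm : 0 < m) (hδ : 0 < δ) :
    ∃ m₁ > 0, ∃ δ₁ > 0, ∃ K > 0,
      ∀ (u₀ v₀ : ℝ → ℝ) (uminus vminus : ℝ), DampedPSystem.InX m δ u₀ v₀ →
        0 < uminus →
        Tendsto u₀ atBot (𝓝 uminus) → Tendsto v₀ atBot (𝓝 vminus) →
        -- the supremum of `|s(0,x) + r(0,y)|` is less than `u₋^{-(γ-1)/2} / (γ-1)`
        (∃ D < 1 / (γ - 1) * uminus ^ (-(γ - 1) / 2), ∀ x y,
          |DampedPSystem.riemannS γ u₀ v₀ x + DampedPSystem.riemannR γ u₀ v₀ y| ≤ D) →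
        -- uniform bounds, for as long as the solution exists
        (∀ (T : ENNReal) (u v : ℝ → ℝ → ℝ), DampedPSystem.IsSolution γ lam μ u₀ v₀ T u v →
          ∀ t : ℝ, 0 ≤ t → ENNReal.ofReal t < T → DampedPSystem.InX m₁ δ₁ (u t) (v t)) ∧
        -- blow-up for steep data
        ((∃ x₀ : ℝ, deriv (DampedPSystem.riemannR γ u₀ v₀) x₀ ≤ -K ∨
            deriv (DampedPSystem.riemannS γ u₀ v₀) x₀ ≤ -K) →
          DampedPSystem.lifespan γ lam μ u₀ v₀ < ⊤ ∧
          -- the breakdown of a solution, i.e. of the finiteness of its norms, is a blow-up of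
          -- the first derivatives
          ∀ (T : ENNReal) (u v : ℝ → ℝ → ℝ), DampedPSystem.IsSolution γ lam μ u₀ v₀ T u v →
            ¬ DampedPSystem.NormsBounded γ T u v → DampedPSystem.DerivativeBlowUp T u v) := by
  have hlam : 0 ≤ lam := hdamp.elim (fun h => h.2.1) (fun h => h.2)
  have hμ : 0 ≤ μ := hdamp.elim (fun h => h.1 ▸ zero_le_one) (fun h => by linarith [h.1])
  obtain ⟨m₁, hm₁, δ₁, hδ₁, hbd⟩ :=
    DampedPSystem.exists_uniform_bounds (lam := lam) (μ := μ) hγ hlam hμ hm hδ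
  obtain ⟨K, hK, B, hB, hlife⟩ :=
    DampedPSystem.exists_lifespan_bound (M := m₁) hγ hlam hμ hδ₁
  refine ⟨m₁, hm₁, δ₁, hδ₁, K, hK, fun u₀ v₀ um vm hX hum hu hv hD => ?_⟩
  have hbd' := hbd u₀ v₀ um vm hX hum hu hv hD
  refine ⟨hbd', fun hsteep => ⟨?_, fun T u v h hN => h.derivativeBlowUp hγ hδ₁ (hbd' T u v h) hN⟩⟩
  -- Every admissible `T` is at most `B`; otherwise a real time strictly between `B` and `T` would
  -- contradict the lifespan bound, even when `T = ∞`.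
  refine lt_of_le_of_lt (sSup_le ?_) (ENNReal.ofReal_lt_top (r := B))
  rintro T ⟨-, u, v, hcl, C, hC⟩
  have h : DampedPSystem.IsSolution γ lam μ u₀ v₀ T u v :=
    ⟨hcl, fun T' hT' => ⟨C, fun t x hq => hC t x ⟨hq.1, hq.2.trans hT'⟩⟩⟩
  by_contra! hlt
  obtain ⟨t₁, ht₁, hBt, htT⟩ := ENNReal.lt_iff_exists_real_btwn.1 hlt
  have hin : ∀ t x, (t, x) ∈ DampedPSystem.strip T → u t x ∈ Icc δ₁ m₁ := fun t x hq => by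
    have hx := hbd' T u v h t hq.1 hq.2
    exact ⟨hx.le_u x, (le_abs_self _).trans
      ((le_add_of_nonneg_right (abs_nonneg _)).trans (hx.norm_le x x))⟩
  have hR : DampedPSystem.riemann γ 1 u v 0 = DampedPSystem.riemannR γ u₀ v₀ := by
    funext x
    simp [DampedPSystem.riemann, DampedPSystem.riemannR, hcl.u_init, hcl.v_init]
  have hS : DampedPSystem.riemann γ (-1) u v 0 = DampedPSystem.riemannS γ u₀ v₀ := by
    funext x
    simp [DampedPSystem.riemann, DampedPSystem.riemannS, hcl.u_init, hcl.v_init]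
  refine hBt.not_ge (ENNReal.ofReal_le_ofReal ?_)
  obtain ⟨x₀, hx | hx⟩ := hsteep
  · rw [← hR] at hx
    exact hlife u₀ v₀ T u v h hin 1 (by norm_num) x₀ hx t₁ ht₁ htT
  · rw [← hS] at hx
    exact hlife u₀ v₀ T u v h hin (-1) (by norm_num) x₀ hx t₁ ht₁ htT
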